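/- Let $\mathbf{CartSp}$ be the category whose objects are the Cartesian spaces $\mathbb{R}^n$ ($n\in\mathbb{N}$) and whose morphisms $\mathbb{R}^m\to\mathbb{R}^n$ are the smooth (i.e. $C^\infty$) functions. Then $\mathbf{CartSp}$ has finite products, but it is not cartesian closed. More precisely, for every choice of finite products, the exponential $\mathbb{R}\Rightarrow\mathbb{R}$ does not exist in $\mathbf{CartSp}$: there are no object $E$ and morphism $\mathrm{ev}:\mathbb{R}\times E\to\mathbb{R}$ such that for every object $Z$ and every morphism $f:\mathbb{R}\times Z\to\mathbb{R}$ there is a unique morphism $g:Z\to E$ with $\mathrm{ev}\circ(\mathrm{id}_{\mathbb{R}}\times g)=f$. -/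

import Mathlib

open CategoryTheory CategoryTheory.Limits MonoidalCategory
open scoped ContDiff

/-- A cartesian space `ℝⁿ`, recorded by its dimension `n` (with `n = 0` allowed). -/
structure CartSp : Type where
  /-- the dimension -/
  dim : ℕ

namespace CartSp

/-- The underlying Euclidean space `ℝⁿ`. -/
abbrev Carrier (X : CartSp) : Type := EuclideanSpace ℝ (Fin X.dim)

/-- Morphisms of cartesian spaces: the smooth functions `ℝᵐ → ℝⁿ`. -/
@[ext]
structure Hom (X Y : CartSp) : Type where
  /-- the underlying function -/
  toFun : X.Carrier → Y.Carrier
  /-- the function is infinitely differentiable -/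
  smooth : ContDiff ℝ ∞ toFun

/-- The category of cartesian spaces and smooth functions. -/
instance : Category CartSp where
  Hom X Y := Hom X Y
  id X := ⟨fun x => x, contDiff_id⟩
  comp f g := ⟨fun x => g.toFun (f.toFun x), g.smooth.comp f.smooth⟩

/-- The real line `ℝ = ℝ¹` as a cartesian space. -/
def real : CartSp := ⟨1⟩

end CartSp

/-- The exponential `X ⇒ Y` exists in a category with finite products: there are an object `E` and
an evaluation morphism `ev : X × E ⟶ Y` such that each `f : X × Z ⟶ Y` is of the form
`(id × g) ≫ ev` for exactly one `g : Z ⟶ E`. -/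
def HasExponential {C : Type*} [Category C] [CartesianMonoidalCategory C] (X Y : C) : Prop :=
  ∃ (E : C) (ev : X ⊗ E ⟶ Y), ∀ (Z : C) (f : X ⊗ Z ⟶ Y), ∃! g : Z ⟶ E, X ◁ g ≫ ev = f

/-! An exponential `E` would parametrize all polynomials with `E.dim + 1` coefficients by a smooth
map `g` through which evaluation at each point factors smoothly. These evaluations are linear and
jointly injective, so by the chain rule `g` has injective derivative at 0, forcing `E.dim + 1 ≤
E.dim` (`dim_le_of_polyEval_factors`). -/

namespace CartSp

/-- The product of a finite family of cartesian spaces, whose dimension is the sum of the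
dimensions of the factors. -/
def pi {n : ℕ} (X : Fin n → CartSp) : CartSp := ⟨∑ i, (X i).dim⟩

/-- The projections of `CartSp.pi`. -/
def piProj {n : ℕ} (X : Fin n → CartSp) (i : Fin n) : pi X ⟶ X i where
  toFun x := WithLp.toLp 2 fun j => x (finSigmaFinEquiv ⟨i, j⟩)
  smooth := contDiff_euclidean.2 fun j =>
    contDiff_euclidean.1 (contDiff_id (E := (pi X).Carrier)) (finSigmaFinEquiv ⟨i, j⟩)

/-- The morphism into `CartSp.pi` given by a family of morphisms. -/
def piLift {n : ℕ} (X : Fin n → CartSp) {Z : CartSp} (f : ∀ i, Z ⟶ X i) : Z ⟶ pi X where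
  toFun z := WithLp.toLp 2 fun k =>
    (f (finSigmaFinEquiv.symm k).1).toFun z (finSigmaFinEquiv.symm k).2
  smooth := contDiff_euclidean.2 fun k =>
    contDiff_euclidean.1 (f (finSigmaFinEquiv.symm k).1).smooth (finSigmaFinEquiv.symm k).2

theorem piLift_apply {n : ℕ} (X : Fin n → CartSp) {Z : CartSp} (f : ∀ i, Z ⟶ X i)
    (z : Z.Carrier) (p : (i : Fin n) × Fin (X i).dim) :
    (piLift X f).toFun z (finSigmaFinEquiv p) = (f p.1).toFun z p.2 := by
  change (f (finSigmaFinEquiv.symm (finSigmaFinEquiv p)).1).toFun z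
    (finSigmaFinEquiv.symm (finSigmaFinEquiv p)).2 = _
  rw [Equiv.symm_apply_apply]

/-- `CartSp.pi` with its projections is a product. -/
def piIsLimit {n : ℕ} (X : Fin n → CartSp) : IsLimit (Fan.mk (pi X) (piProj X)) :=
  Fan.IsLimit.mk _ (fun s => piLift X s.proj)
    (fun s i => by
      refine Hom.ext (funext fun z => ?_)
      ext j
      exact piLift_apply X s.proj z ⟨i, j⟩)
    (fun s m hm => by
      refine Hom.ext (funext fun z => ?_)
      ext k
      obtain ⟨p, rfl⟩ := finSigmaFinEquiv.surjective k
      refine Eq.trans ?_ (piLift_apply X s.proj z p).symm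
      rw [← hm p.1]
      rfl)

instance : HasFiniteProducts CartSp where
  out _ := { has_limit := fun F =>
    have : HasLimit (Discrete.functor (F.obj ∘ Discrete.mk)) := ⟨⟨_, piIsLimit _⟩⟩
    hasLimit_of_iso Discrete.natIsoFunctor.symm }

/-- The constant morphism. -/
def const (Z X : CartSp) (x : X.Carrier) : Z ⟶ X := ⟨fun _ => x, contDiff_const⟩

/-- The smooth function `(x, a) ↦ ∑ i, a i * x ^ i` of two generalized elements `x` and `a`. -/
def polyEval {W Z : CartSp} (x : W ⟶ real) (a : W ⟶ Z) : W ⟶ real where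
  toFun w := WithLp.toLp 2 fun _ => ∑ i : Fin Z.dim, a.toFun w i * x.toFun w (0 : Fin 1) ^ (i : ℕ)
  smooth := contDiff_euclidean.2 fun _ => ContDiff.sum (s := Finset.univ) fun (i : Fin Z.dim) _ =>
    (contDiff_euclidean.1 a.smooth i).mul ((contDiff_euclidean.1 x.smooth (0 : Fin 1)).pow (i : ℕ))

theorem comp_polyEval {V W Z : CartSp} (s : V ⟶ W) (x : W ⟶ real) (a : W ⟶ Z) :
    s ≫ polyEval x a = polyEval (s ≫ x) (s ≫ a) := rfl

/-- The continuous linear map `a ↦ ∑ i, a i * t ^ i`. -/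
noncomputable def polyEvalCLM (Z : CartSp) (t : ℝ) : Z.Carrier →L[ℝ] ℝ :=
  ∑ i : Fin Z.dim, t ^ (i : ℕ) • EuclideanSpace.proj (𝕜 := ℝ) i

theorem polyEvalCLM_apply (Z : CartSp) (t : ℝ) (a : Z.Carrier) :
    polyEvalCLM Z t a = ∑ i : Fin Z.dim, a i * t ^ (i : ℕ) := by
  simp [polyEvalCLM, mul_comm]

/-- Vandermonde at the nodes 0, 1, …, `Z.dim - 1`. -/
theorem eq_zero_of_polyEvalCLM_eq_zero {Z : CartSp} {a : Z.Carrier}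
    (h : ∀ t, polyEvalCLM Z t a = 0) : a = 0 := by
  have hinj : Function.Injective fun j : Fin Z.dim => ((j : ℕ) : ℝ) :=
    Nat.cast_injective.comp Fin.val_injective
  have h0 := Matrix.eq_zero_of_forall_index_sum_mul_pow_eq_zero hinj (v := a)
    fun j => (polyEvalCLM_apply Z _ a).symm.trans (h _)
  ext i
  exact congrFun h0 i

/-- If a smooth map through which all evaluations of polynomials factor smoothly has source `Z`,
then its target has at least the dimension of `Z`. -/
theorem dim_le_of_polyEval_factors {Z E : CartSp} (g : Z ⟶ E)
    (h : ∀ t : real.Carrier, ∃ k : E ⟶ real, g ≫ k = polyEval (const Z real t) (𝟙 Z)) :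
    Z.dim ≤ E.dim := by
  have hg : DifferentiableAt ℝ g.toFun 0 := g.smooth.differentiable (by simp) 0
  have hker : ∀ a, fderiv ℝ g.toFun 0 a = 0 → a = 0 := fun a ha =>
    eq_zero_of_polyEvalCLM_eq_zero fun t => by
      obtain ⟨k, hk⟩ := h (WithLp.toLp 2 fun _ => t)
      have hd : DifferentiableAt ℝ (fun e => k.toFun e (0 : Fin 1)) (g.toFun 0) :=
        (contDiff_euclidean.1 k.smooth (0 : Fin 1)).differentiable (by simp) _
      have hcomp : (fun e => k.toFun e (0 : Fin 1)) ∘ g.toFun = polyEvalCLM Z t := by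
        funext z
        rw [polyEvalCLM_apply]
        exact congrArg (fun q : Hom Z real => q.toFun z (0 : Fin 1)) hk
      -- A linear form is its own derivative, so it factors through that of `g` and kills its
      -- kernel.
      have hchain := hd.hasFDerivAt.comp 0 hg.hasFDerivAt
      rw [hcomp] at hchain
      rw [(polyEvalCLM Z t).hasFDerivAt.unique hchain, ContinuousLinearMap.comp_apply, ha, map_zero]
  have hle := LinearMap.finrank_le_finrank_of_injective
    (f := (fderiv ℝ g.toFun 0).toLinearMap) ((injective_iff_map_eq_zero _).2 hker)
  simpa using hle

theorem not_hasExponential_real [CartesianMonoidalCategory CartSp] :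
    ¬ HasExponential real real := by
  rintro ⟨E, ev, h⟩
  -- One coefficient more than `E` has room for.
  let Z : CartSp := ⟨E.dim + 1⟩
  obtain ⟨g, hg, -⟩ := h Z (polyEval (SemiCartesianMonoidalCategory.fst real Z)
    (SemiCartesianMonoidalCategory.snd real Z))
  refine Nat.not_succ_le_self E.dim (dim_le_of_polyEval_factors (Z := Z) g fun t =>
    ⟨CartesianMonoidalCategory.lift (const E real t) (𝟙 E) ≫ ev, ?_⟩)
  have hconst : g ≫ const E real t = const Z real t := rfl
  -- Restricting along `z ↦ (t, z)` freezes the evaluation point at `t`.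
  have hsection := congrArg
    (CartesianMonoidalCategory.lift (const Z real t) (𝟙 Z) ≫ ·) hg
  simpa [comp_polyEval, hconst, CartesianMonoidalCategory.comp_lift_assoc] using hsection

end CartSp

theorem MonoidalClosed.hasExponential {C : Type*} [Category C] [CartesianMonoidalCategory C]
    [MonoidalClosed C] (X Y : C) : HasExponential X Y :=
  ⟨(ihom X).obj Y, (ihom.ev X).app Y, fun Z f => ⟨MonoidalClosed.curry f,
    (MonoidalClosed.uncurry_eq _).symm.trans (MonoidalClosed.uncurry_curry f), fun g hg => by
      rw [← hg, ← MonoidalClosed.uncurry_eq, MonoidalClosed.curry_uncurry]⟩⟩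

theorem mainTheorem7 :
    HasFiniteProducts CartSp ∧
      ∀ [CartesianMonoidalCategory CartSp],
        ¬ HasExponential CartSp.real CartSp.real ∧ IsEmpty (MonoidalClosed CartSp) := by
  refine ⟨inferInstance, fun {_} => ⟨CartSp.not_hasExponential_real, ⟨fun _ => ?_⟩⟩⟩
  exact CartSp.not_hasExponential_real (MonoidalClosed.hasExponential _ _)
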